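/- For a finite group $G$, the proper power graph $\mathcal{P}^*(G)$ is the simple graph whose vertices are the non-identity elements of $G$, two distinct vertices $x,y$ being adjacent if and only if $y=x^m$ or $x=y^m$ for some positive integer $m$. Let $n\ge 3$ be an integer and let $p'$ be the largest prime factor of $n(n-1)(n-2)$. If $\left\lfloor \frac{n-2}{p'}\right\rfloor \ge 3p'+2$, then the proper power graph $\mathcal{P}^*(A_n)$ of the alternating group $A_n$ of degree $n$ is connected and $\operatorname{diam}(\mathcal{P}^*(A_n))\le 8$, where $\operatorname{diam}$ is the maximum, over all pairs of vertices, of the length of a shortest path between them. -/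

import Mathlib

/-- The power graph of a group `G`: the vertices are the elements of `G`, and `x`, `y` are adjacent
iff `x ≠ y` and one of them is a positive power of the other. -/
def powerGraph (G : Type*) [Group G] : SimpleGraph G where
  Adj x y := x ≠ y ∧ ∃ m : ℕ, 0 < m ∧ (y = x ^ m ∨ x = y ^ m)
  symm := ⟨fun _ _ h => ⟨h.1.symm, h.2.imp fun _ hm => ⟨hm.1, hm.2.symm⟩⟩⟩
  loopless := ⟨fun _ h => h.1 rfl⟩

/-- The proper power graph: the power graph with the identity vertex deleted. -/
def properPowerGraph (G : Type*) [Group G] : SimpleGraph {x : G // x ≠ 1} :=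
  (powerGraph G).induce {x : G | x ≠ 1}

section

open Equiv Equiv.Perm Function

/-! ### Distances in the proper power graph of a group -/

section PowerGraph

variable {G : Type*} [Group G]

/-! Commuting elements of coprime orders are both powers of their product, hence at distance at most
2. Permuting `m` equal-length cycles of `a` by the square of an `m`-cycle gives an even permutation
commuting with `a`, of order 3, 2, 5 for `m` = 3, 4, 5. So for `a`, `d` of prime order, take such a
`b` for `a` and a `c` for `d`, of different orders, with `c` built only from cycles of `d` that miss
the support of `b`. Then `b` and `c` commute, and `a`, `b`, `c`, `d` is a chain of three steps of
length at most 2 (`edist_le_six_of_hasCycles`). It remains to count cycles.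

Any vertex is within 1 of a tame element of prime order, or has prime order other than 3 and at
least three fixed points (`exists_isTame_or_prime`). Two tame elements are within 6, which gives 1 +
6 + 1. The exceptional vertices are linked through 3-cycles on their fixed points. A prime-order
element with at most two fixed points has order dividing `n`, `n - 1` or `n - 2`, hence at most
`p'`. The tight case is two such elements of order `p'`: the naive count needs `3 * p' + 4` cycles,
and `edist_le_six_of_orderOf_eq` saves two. -/

theorem properPowerGraph_edist_le_one {x y : {g : G // g ≠ 1}} (m : ℕ) (h : (y : G) = (x : G) ^ m) :
    (properPowerGraph G).edist x y ≤ 1 := by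
  rw [SimpleGraph.edist_le_one_iff_adj_or_eq]
  by_cases hxy : x = y
  · exact Or.inr hxy
  · refine Or.inl ⟨fun h' => hxy (Subtype.ext h'), m, Nat.pos_of_ne_zero ?_, Or.inl h⟩
    rintro rfl
    exact y.2 (by simpa using h)

theorem exists_mul_pow_eq_left {x y : G} (hc : Commute x y)
    (h : (orderOf x).Coprime (orderOf y)) : ∃ m : ℕ, x = (x * y) ^ m := by
  obtain ⟨m, hm⟩ := exists_pow_eq_self_of_coprime h.symm
  refine ⟨orderOf y * m, ?_⟩
  rw [pow_mul, hc.mul_pow, pow_orderOf_eq_one, mul_one, hm]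

theorem properPowerGraph_edist_le_two {x y : {g : G // g ≠ 1}} (hc : Commute (x : G) (y : G))
    (h : (orderOf (x : G)).Coprime (orderOf (y : G))) :
    (properPowerGraph G).edist x y ≤ 2 := by
  obtain ⟨m, hm⟩ := exists_mul_pow_eq_left hc h
  obtain ⟨k, hk⟩ := exists_mul_pow_eq_left hc.symm h.symm
  rw [← hc.eq] at hk
  have hne : (x : G) * y ≠ 1 := fun h1 => x.2 (by rw [hm, h1, one_pow])
  have h1 := properPowerGraph_edist_le_one (x := ⟨_, hne⟩) (y := x) m hm
  have h2 := properPowerGraph_edist_le_one (x := ⟨_, hne⟩) (y := y) k hk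
  rw [SimpleGraph.edist_comm] at h1
  calc _ ≤ _ := SimpleGraph.edist_triangle
    _ ≤ 1 + 1 := add_le_add h1 h2
    _ = 2 := by norm_num

end PowerGraph

/-! ### Even permutations that permute the cycles of a given one -/

section Cycles

theorem Equiv.Perm.SameCycle.exists_iterate_lt {α : Type*} [Finite α] {a : Perm α} {q : ℕ} {x y : α} (hq : 0 < q)
    (hx : minimalPeriod a x = q) (h : SameCycle a x y) : ∃ i < q, a^[i] x = y := by
  obtain ⟨i, hi⟩ := h.exists_nat_pow_eq
  refine ⟨i % q, Nat.mod_lt _ hq, ?_⟩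
  rw [← hx, iterate_mod_minimalPeriod_eq, ← hi, Perm.iterate_eq_pow]

theorem Equiv.Perm.sameCycle_iterate {α : Type*} (a : Perm α) (i : ℕ) (x : α) : SameCycle a x (a^[i] x) :=
  ⟨i, by simp [Perm.iterate_eq_pow]⟩

variable {α : Type*} [Fintype α] [DecidableEq α]

/-- The permutation which moves the cycles of `a` through the points `u j` as `τ ^ 2` moves the
indices. -/
theorem exists_even_perm_permuting_cycles (a : Perm α) {q m : ℕ} (hq : 0 < q) (u : Fin m → α)
    (hper : ∀ j, minimalPeriod a (u j) = q) (hdist : ∀ j k, SameCycle a (u j) (u k) → j = k)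
    (τ : Perm (Fin m)) :
    ∃ c : Perm α, sign c = 1 ∧ orderOf c = orderOf (τ ^ 2) ∧ Commute a c ∧
      c.support.card ≤ q * m ∧ ∀ x, c x ≠ x → ∃ j, SameCycle a (u j) x := by
  have hinj : Injective (fun z : Fin m × Fin q => a^[(z.2 : ℕ)] (u z.1)) := by
    rintro ⟨j, i⟩ ⟨k, l⟩ h
    have hjk : j = k := hdist _ _ (by
      have h1 := sameCycle_iterate a i (u j)
      have h2 := sameCycle_iterate a l (u k)
      simp only at h
      rw [h] at h1
      exact h1.trans h2.symm)
    subst hjk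
    have := (iterate_eq_iterate_iff_of_lt_minimalPeriod (f := a) (x := u j)
      (by rw [hper]; exact i.2) (by rw [hper]; exact l.2)).1 h
    exact Prod.ext rfl (Fin.ext this)
  let e : Fin m × Fin q ↪ α := ⟨_, hinj⟩
  have he : ∀ j (i : ℕ), a^[i] (u j) = e (j, ⟨i % q, Nat.mod_lt _ hq⟩) := fun j i => by
    change _ = a^[i % q] (u j)
    conv_rhs => rw [← hper j, iterate_mod_minimalPeriod_eq]
  let φ : Perm (Fin m) →* Perm α :=
    (viaEmbeddingHom e).comp
      { toFun := fun σ => Equiv.prodCongr σ (Equiv.refl (Fin q))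
        map_one' := rfl
        map_mul' := fun _ _ => rfl }
  have hφ : Injective φ := by
    refine (viaEmbeddingHom_injective e).comp (fun σ σ' h => ?_)
    ext j
    have := congrArg (fun f : Perm (Fin m × Fin q) => (f (j, ⟨0, hq⟩)).1) h
    exact congrArg Fin.val this
  have happ : ∀ σ j (i : ℕ), φ σ (a^[i] (u j)) = a^[i] (u (σ j)) := fun σ j i => by
    rw [he, he]
    change viaEmbedding _ e _ = _
    rw [viaEmbedding_apply]
    rfl
  have hnot : ∀ σ x, (∀ j, ¬ SameCycle a (u j) x) → φ σ x = x := fun σ x hx => by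
    refine viaEmbedding_apply_of_notMem _ _ _ ?_
    rintro ⟨⟨j, i⟩, rfl⟩
    exact hx j (sameCycle_iterate a i (u j))
  have hmem : ∀ x j, SameCycle a (u j) x → ∃ i < q, a^[i] (u j) = x := fun x j hj =>
    hj.exists_iterate_lt hq (hper j)
  -- A square is even whatever the parities of `q` and `τ`.
  refine ⟨φ (τ ^ 2), ?_, orderOf_injective φ hφ _, ?_, ?_, fun x hx => ?_⟩
  · rw [map_pow, map_pow, ← Int.units_sq (sign (φ τ))]
  · ext x
    simp only [Perm.mul_apply]
    by_cases hx : ∃ j, SameCycle a (u j) x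
    · obtain ⟨j, hj⟩ := hx
      obtain ⟨i, -, rfl⟩ := hmem x j hj
      rw [happ, ← iterate_succ_apply' a, ← iterate_succ_apply' a, happ]
    · push Not at hx
      rw [hnot _ _ hx, hnot]
      intro j hj
      exact hx j (sameCycle_apply_right.1 hj)
  · calc _ ≤ (Finset.univ.map e).card := Finset.card_le_card fun x hx => ?_
      _ = q * m := by simp [mul_comm]
    by_contra hx'
    refine mem_support.1 hx (viaEmbedding_apply_of_notMem _ _ _ ?_)
    rintro ⟨z, rfl⟩
    exact hx' (by simp)
  · by_contra h
    push Not at h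
    exact hx (hnot _ _ h)

open Classical in
/-- Enough points of period `q` give `m` distinct cycles of length `q` containing the points of `W`
and avoiding those of `S`. -/
theorem exists_cycle_representatives (a : Perm α) {q m : ℕ} (hq : 0 < q) (S W X : Finset α)
    (hX : ∀ x ∈ X, minimalPeriod a x = q) (hWX : W ⊆ X) (hW : W.card ≤ m)
    (hSW : ∀ s ∈ S, ∀ w ∈ W, ¬ SameCycle a s w) (hcard : q * (S.card + m) ≤ X.card) :
    ∃ u : Fin m → α, (∀ j, minimalPeriod a (u j) = q) ∧
      (∀ j k, SameCycle a (u j) (u k) → j = k) ∧ (∀ w ∈ W, ∃ j, SameCycle a (u j) w) ∧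
      ∀ s ∈ S, ∀ j, ¬ SameCycle a s (u j) := by
  let Q := Quotient (SameCycle.setoid a)
  let π : α → Q := Quotient.mk (SameCycle.setoid a)
  have hπ : ∀ {x y}, π x = π y ↔ SameCycle a x y := fun {x y} =>
    Quotient.eq (r := SameCycle.setoid a)
  have hle : X.card ≤ q * (X.image π).card := by
    refine Finset.card_le_mul_card_image _ _ fun b hb => ?_
    obtain ⟨x, hx, rfl⟩ := Finset.mem_image.1 hb
    calc _ ≤ ((Finset.range q).image fun i => a^[i] x).card := Finset.card_le_card fun y hy => ?_
      _ ≤ q := Finset.card_image_le.trans (by simp)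
    obtain ⟨-, hy⟩ := Finset.mem_filter.1 hy
    obtain ⟨i, hi, h⟩ := (hπ.1 hy.symm).exists_iterate_lt hq (hX x hx)
    exact Finset.mem_image.2 ⟨i, Finset.mem_range.2 hi, h⟩
  have h1 : S.card + m ≤ (X.image π).card := Nat.le_of_mul_le_mul_left (hcard.trans hle) hq
  have h2 : m ≤ (X.image π \ S.image π).card := by
    have := Finset.le_card_sdiff (S.image π) (X.image π)
    have := Finset.card_image_le (s := S) (f := π)
    omega
  obtain ⟨C, hWC, hC, hCm⟩ := Finset.exists_subsuperset_card_eq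
    (s := W.image π) (t := X.image π \ S.image π) (n := m) (fun b hb => by
      obtain ⟨w, hw, rfl⟩ := Finset.mem_image.1 hb
      refine Finset.mem_sdiff.2 ⟨Finset.mem_image_of_mem _ (hWX hw), fun h => ?_⟩
      obtain ⟨s, hs, h⟩ := Finset.mem_image.1 h
      exact hSW s hs w hw (hπ.1 h)) (Finset.card_image_le.trans hW) h2
  have hrep : ∀ b : C, ∃ x ∈ X, π x = b := fun b => by
    simpa using (Finset.mem_sdiff.1 (hC b.2)).1
  choose r hrX hr using hrep
  let f : C ≃ Fin m := C.equivFinOfCardEq hCm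
  refine ⟨fun j => r (f.symm j), fun j => hX _ (hrX _), fun j k h => ?_, fun w hw => ?_,
    fun s hs j h => ?_⟩
  · rw [← hπ, hr, hr] at h
    exact f.symm.injective (Subtype.ext h)
  · refine ⟨f ⟨π w, hWC (Finset.mem_image_of_mem _ hw)⟩, ?_⟩
    rw [← hπ, hr]
    simp
  · rw [← hπ, hr] at h
    exact (Finset.mem_sdiff.1 (hC (f.symm j).2)).2 (Finset.mem_image.2 ⟨s, hs, h⟩)

theorem exists_even_perm_commuting (a : Perm α) {q m : ℕ} (hq : 0 < q) (S X : Finset α)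
    (hX : ∀ x ∈ X, minimalPeriod a x = q) (hcard : q * (S.card + m) ≤ X.card)
    (τ : Perm (Fin m)) (hτ : τ ^ 2 ≠ 1) :
    ∃ c : {g : alternatingGroup α // g ≠ 1}, orderOf (c.1 : Perm α) = orderOf (τ ^ 2) ∧
      Commute a c.1 ∧ (c.1 : Perm α).support.card ≤ q * m ∧
      ∀ s ∈ S, ∀ t, SameCycle a s t → (c.1 : Perm α) t = t := by
  obtain ⟨u, hper, hdist, -, hS⟩ := exists_cycle_representatives a hq S ∅ X hX (by simp) (by simp)
    (by simp) hcard
  obtain ⟨c, hs, ho, hc, hsupp, hmem⟩ := exists_even_perm_permuting_cycles a hq u hper hdist τ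
  refine ⟨⟨⟨c, mem_alternatingGroup.2 hs⟩, fun h => hτ ?_⟩, ho, hc, hsupp, fun s hs t hst => ?_⟩
  · rw [← orderOf_eq_one_iff, ← ho, orderOf_eq_one_iff]
    exact congrArg Subtype.val h
  · by_contra h
    obtain ⟨j, hj⟩ := hmem t h
    exact hS s hs j (hst.trans hj.symm)

end Cycles

/-! ### Chains between elements of prime order -/

section ProperPowerGraphAlternating

variable {α : Type*} [Fintype α] [DecidableEq α]

theorem minimalPeriod_of_notMem_support {a : Perm α} {x : α} (hx : x ∉ a.support) :
    minimalPeriod a x = 1 :=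
  minimalPeriod_eq_one_iff_isFixedPt.2 (notMem_support.1 hx)

theorem minimalPeriod_of_mem_support {a : Perm α} {x : α} (ha : (orderOf a).Prime)
    (hx : x ∈ a.support) : minimalPeriod a x = orderOf a := by
  refine ((Nat.dvd_prime ha).1 (IsPeriodicPt.minimalPeriod_dvd ?_)).resolve_left fun h =>
    mem_support.1 hx (minimalPeriod_eq_one_iff_isFixedPt.1 h)
  change a^[orderOf a] x = x
  rw [Perm.iterate_eq_pow, pow_orderOf_eq_one, Perm.one_apply]

theorem orderOf_dvd_card_support {a : Perm α} (ha : (orderOf a).Prime) :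
    orderOf a ∣ a.support.card := by
  rw [← sum_cycleType]
  refine Multiset.dvd_sum fun k hk => ?_
  have := dvd_of_mem_cycleType hk
  rcases (Nat.dvd_prime ha).1 this with h | h
  · exact absurd (two_le_of_mem_cycleType hk) (by omega)
  · rw [h]

/-- `a` has at least `k` cycles of length `q`. -/
def HasCycles (a : Perm α) (q k : ℕ) : Prop :=
  0 < q ∧ ∃ X : Finset α, (∀ x ∈ X, minimalPeriod a x = q) ∧ q * k ≤ X.card

theorem HasCycles.mono {α : Type*} {a : Perm α} {q k l : ℕ} (h : HasCycles a q k) (hl : l ≤ k) :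
    HasCycles a q l :=
  ⟨h.1, h.2.imp fun _ hX => ⟨hX.1, (Nat.mul_le_mul_left _ hl).trans hX.2⟩⟩

theorem hasCycles_one {a : Perm α} {k : ℕ} (h : a.support.card + k ≤ Fintype.card α) :
    HasCycles a 1 k := by
  refine ⟨one_pos, a.supportᶜ, fun x hx =>
    minimalPeriod_of_notMem_support (Finset.mem_compl.1 hx), ?_⟩
  rw [Finset.card_compl]
  omega

theorem hasCycles_orderOf {a : Perm α} (ha : (orderOf a).Prime) {k : ℕ}
    (h : orderOf a * k ≤ a.support.card) : HasCycles a (orderOf a) k :=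
  ⟨ha.pos, a.support, fun _ hx => minimalPeriod_of_mem_support ha hx, h⟩

theorem HasCycles.exists_commuting {a : Perm α} {q m : ℕ} (S : Finset α)
    (h : HasCycles a q (S.card + m)) (hm : (orderOf (finRotate m ^ 2)).Prime) :
    ∃ c : {g : alternatingGroup α // g ≠ 1}, orderOf (c.1 : Perm α) = orderOf (finRotate m ^ 2) ∧
      Commute a c.1 ∧ (c.1 : Perm α).support.card ≤ q * m ∧
      ∀ s ∈ S, ∀ t, SameCycle a s t → (c.1 : Perm α) t = t := by
  obtain ⟨hq, X, hX, hcard⟩ := h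
  refine exists_even_perm_commuting a hq S X hX hcard (finRotate m) fun h1 => hm.ne_one ?_
  rw [h1, orderOf_one]

theorem orderOf_finRotate_sq_three : orderOf (finRotate 3 ^ 2) = 3 :=
  orderOf_eq_prime (by decide) (by decide)

theorem orderOf_finRotate_sq_four : orderOf (finRotate 4 ^ 2) = 2 :=
  orderOf_eq_prime (by decide) (by decide)

theorem orderOf_finRotate_sq_five : orderOf (finRotate 5 ^ 2) = 5 :=
  haveI : Fact (Nat.Prime 5) := ⟨by norm_num⟩
  orderOf_eq_prime (by decide) (by decide)

theorem edist_le_two_of_commute {a b : {g : alternatingGroup α // g ≠ 1}}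
    (hc : Commute (a.1 : Perm α) b.1) (ha : (orderOf (a.1 : Perm α)).Prime)
    (hb : (orderOf (b.1 : Perm α)).Prime) (hab : orderOf (a.1 : Perm α) ≠ orderOf (b.1 : Perm α)) :
    (properPowerGraph (alternatingGroup α)).edist a b ≤ 2 := by
  refine properPowerGraph_edist_le_two (Subtype.ext hc) ?_
  rw [← Subgroup.orderOf_coe, ← Subgroup.orderOf_coe]
  exact (Nat.coprime_primes ha hb).2 hab

theorem edist_le_six_of_chain {a b c d : {g : alternatingGroup α // g ≠ 1}}
    (h1 : (properPowerGraph (alternatingGroup α)).edist a b ≤ 2)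
    (h2 : (properPowerGraph (alternatingGroup α)).edist b c ≤ 2)
    (h3 : (properPowerGraph (alternatingGroup α)).edist c d ≤ 2) :
    (properPowerGraph (alternatingGroup α)).edist a d ≤ 6 :=
  calc _ ≤ _ := SimpleGraph.edist_triangle.trans
        (add_le_add_right SimpleGraph.edist_triangle _)
    _ ≤ 2 + (2 + 2) := add_le_add h1 (add_le_add h2 h3)
    _ = 6 := by norm_num

/-- The support of `b` has at most `q₁ * m₁` points, so it spoils at most that many cycles of `d`,
and `m₂` remain to build `c`. -/
theorem edist_le_six_of_hasCycles {a d : {g : alternatingGroup α // g ≠ 1}}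
    (ha : (orderOf (a.1 : Perm α)).Prime) (hd : (orderOf (d.1 : Perm α)).Prime)
    {k l q₁ m₁ q₂ m₂ : ℕ} (hk : orderOf (finRotate m₁ ^ 2) = k)
    (hl : orderOf (finRotate m₂ ^ 2) = l) (hkp : k.Prime) (hlp : l.Prime)
    (h₁ : HasCycles (a.1 : Perm α) q₁ m₁) (h₂ : HasCycles (d.1 : Perm α) q₂ (q₁ * m₁ + m₂))
    (hak : orderOf (a.1 : Perm α) ≠ k) (hdl : orderOf (d.1 : Perm α) ≠ l) (hkl : k ≠ l) :
    (properPowerGraph (alternatingGroup α)).edist a d ≤ 6 := by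
  subst hk hl
  obtain ⟨b, hbo, hbc, hbs, -⟩ :=
    HasCycles.exists_commuting ∅ (h₁.mono (by simp)) hkp
  obtain ⟨c, hco, hcc, -, hcS⟩ :=
    HasCycles.exists_commuting (b.1 : Perm α).support (h₂.mono (by omega)) hlp
  have hdisj : Perm.Disjoint (b.1 : Perm α) c.1 := fun x => by
    by_cases hx : x ∈ (b.1 : Perm α).support
    · exact Or.inr (hcS x hx x (SameCycle.refl _ _))
    · exact Or.inl (notMem_support.1 hx)
  rw [← hbo] at hkp hak hkl
  rw [← hco] at hlp hdl hkl
  exact edist_le_six_of_chain (edist_le_two_of_commute hbc ha hkp hak)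
    (edist_le_two_of_commute hdisj.commute hkp hlp hkl)
    (edist_le_two_of_commute hcc.symm hlp hd hdl.symm)

/-- Three fixed points of each element carry a 3-cycle commuting with it. The two 3-cycles occupy at
most 6 points, leaving 5 for a 5-cycle disjoint from both. -/
theorem edist_le_eight_of_three_fixed {a d : {g : alternatingGroup α // g ≠ 1}}
    (ha : (orderOf (a.1 : Perm α)).Prime) (hd : (orderOf (d.1 : Perm α)).Prime)
    (ha3 : orderOf (a.1 : Perm α) ≠ 3) (hd3 : orderOf (d.1 : Perm α) ≠ 3)
    (has : (a.1 : Perm α).support.card + 3 ≤ Fintype.card α)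
    (hds : (d.1 : Perm α).support.card + 3 ≤ Fintype.card α) (hN : 11 ≤ Fintype.card α) :
    (properPowerGraph (alternatingGroup α)).edist a d ≤ 8 := by
  have h3 : (orderOf (finRotate 3 ^ 2)).Prime := by rw [orderOf_finRotate_sq_three]; norm_num
  have h5 : (orderOf (finRotate 5 ^ 2)).Prime := by rw [orderOf_finRotate_sq_five]; norm_num
  obtain ⟨b, hbo, hbc, hbs, -⟩ :=
    HasCycles.exists_commuting ∅ ((hasCycles_one has).mono (by simp)) h3
  obtain ⟨c, hco, hcc, hcs, -⟩ :=
    HasCycles.exists_commuting ∅ ((hasCycles_one hds).mono (by simp)) h3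
  have hone : HasCycles (1 : Perm α) 1 11 := hasCycles_one (by simpa using hN)
  have hcard := Finset.card_union_le (b.1 : Perm α).support (c.1 : Perm α).support
  obtain ⟨e, heo, -, -, heS⟩ :=
    HasCycles.exists_commuting ((b.1 : Perm α).support ∪ (c.1 : Perm α).support)
      (hone.mono (by omega)) h5
  have hdisj : ∀ f : Perm α, f.support ⊆ (b.1 : Perm α).support ∪ (c.1 : Perm α).support →
      Commute f e.1 := fun f hf => by
    refine Perm.Disjoint.commute fun x => ?_
    by_cases hx : x ∈ f.support
    · exact Or.inr (heS x (hf hx) x (SameCycle.refl _ _))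
    · exact Or.inl (notMem_support.1 hx)
  rw [orderOf_finRotate_sq_three] at hbo hco h3
  rw [orderOf_finRotate_sq_five] at heo h5
  rw [← hbo] at ha3
  rw [← hco] at hd3
  have h1 := edist_le_two_of_commute hbc ha (hbo ▸ h3) ha3
  have h2 := edist_le_two_of_commute (hdisj _ Finset.subset_union_left) (hbo ▸ h3) (heo ▸ h5)
    (by rw [hbo, heo]; norm_num)
  have h3' := edist_le_two_of_commute (hdisj _ Finset.subset_union_right).symm (heo ▸ h5)
    (hco ▸ h3) (by rw [hco, heo]; norm_num)
  have h4 := edist_le_two_of_commute hcc.symm (hco ▸ h3) hd hd3.symm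
  calc _ ≤ _ := SimpleGraph.edist_triangle
    _ ≤ 6 + 2 := add_le_add (edist_le_six_of_chain h1 h2 h3') h4
    _ = 8 := by norm_num

/-- Two elements of the same prime order `q` with few fixed points and at least `3 * q + 2` cycles:
three cycles of `a` can be chosen so that they meet at most `3 * q - 2` cycles of `d`. -/
theorem edist_le_six_of_orderOf_eq {a d : {g : alternatingGroup α // g ≠ 1}} {q : ℕ}
    (hqp : q.Prime) (ha : orderOf (a.1 : Perm α) = q) (hd : orderOf (d.1 : Perm α) = q)
    (hq : 5 ≤ q) (has : Fintype.card α ≤ (a.1 : Perm α).support.card + 2)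
    (hds : Fintype.card α ≤ (d.1 : Perm α).support.card + 2)
    (hN : q * (3 * q + 2) + 2 ≤ Fintype.card α) :
    (properPowerGraph (alternatingGroup α)).edist a d ≤ 6 := by
  set a' : Perm α := a.1.1 with ha'
  set d' : Perm α := d.1.1 with hd'
  have hac : a'.supportᶜ.card ≤ 2 := by rw [Finset.card_compl]; omega
  have hdc : d'.supportᶜ.card ≤ 2 := by rw [Finset.card_compl]; omega
  have hperA : ∀ x ∈ a'.support, minimalPeriod a' x = q := fun x hx =>
    (minimalPeriod_of_mem_support (ha ▸ hqp) hx).trans ha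
  have hperD : ∀ x ∈ d'.support, minimalPeriod d' x = q := fun x hx =>
    (minimalPeriod_of_mem_support (hd ▸ hqp) hx).trans hd
  -- The point `z₁` is moved by `a'` and `d'`, and its image `z₂` is moved by `d'`; at most 6 points
  -- are excluded.
  obtain ⟨z₁, hz⟩ : ∃ z, z ∉ a'.supportᶜ ∪ (d'.supportᶜ ∪ d'.supportᶜ.image a'.symm) := by
    by_contra! h
    have h1 := Finset.card_le_card (fun x _ => h x : Finset.univ ⊆ _)
    have h2 := Finset.card_union_le a'.supportᶜ (d'.supportᶜ ∪ d'.supportᶜ.image a'.symm)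
    have h3 := Finset.card_union_le d'.supportᶜ (d'.supportᶜ.image a'.symm)
    have h4 : (d'.supportᶜ.image a'.symm).card ≤ d'.supportᶜ.card := Finset.card_image_le
    rw [Finset.card_univ] at h1
    nlinarith
  simp only [Finset.mem_union, Finset.mem_compl, not_or, not_not] at hz
  obtain ⟨hz₁a, hz₁d, hz₂d⟩ := hz
  set z₂ := a' z₁ with hz₂
  replace hz₂d : z₂ ∈ d'.support := by
    by_contra h
    exact hz₂d (Finset.mem_image.2 ⟨z₂, by simpa using h, by simp [hz₂]⟩)
  have hz₁₂ : z₂ ≠ z₁ := mem_support.1 hz₁a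
  -- A cycle of `d'` has `q ≥ 5` points, of which at most 4 are excluded: `z₁`, `z₂` and two fixed
  -- points of `a'`.
  have hw : ∀ z ∈ d'.support, ∃ w ∈ a'.support, SameCycle d' w z ∧ w ≠ z₁ ∧ w ≠ z₂ := by
    intro z hz
    have hinj : Set.InjOn (fun i : ℕ => d'^[i] z) (Finset.range q) := by
      have := iterate_injOn_Iio_minimalPeriod (f := d') (x := z)
      rwa [hperD z hz, ← Finset.coe_range] at this
    have hcard : ((Finset.range q).image fun i => d'^[i] z).card = q := by
      rw [Finset.card_image_of_injOn hinj, Finset.card_range]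
    obtain ⟨w, hw, hw'⟩ := Finset.exists_mem_notMem_of_card_lt_card
      (s := {z₁, z₂} ∪ a'.supportᶜ) (t := (Finset.range q).image fun i => d'^[i] z) (by
        have h1 := Finset.card_union_le {z₁, z₂} a'.supportᶜ
        have h2 := Finset.card_le_two (a := z₁) (b := z₂)
        omega)
    obtain ⟨i, -, rfl⟩ := Finset.mem_image.1 hw
    simp only [Finset.mem_union, Finset.mem_insert, Finset.mem_singleton, Finset.mem_compl, not_or,
      not_not] at hw'
    exact ⟨_, hw'.2, (sameCycle_iterate _ _ _).symm, hw'.1.1, hw'.1.2⟩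
  obtain ⟨w₁, hw₁a, hw₁z, hw₁⟩ := hw z₁ hz₁d
  obtain ⟨w₂, hw₂a, hw₂z, hw₂⟩ := hw z₂ hz₂d
  obtain ⟨u, hper, hdist, hW, -⟩ := exists_cycle_representatives a' (m := 3) hqp.pos ∅
    {z₁, w₁, w₂} a'.support hperA (by
      intro x hx
      simp only [Finset.mem_insert, Finset.mem_singleton] at hx
      rcases hx with rfl | rfl | rfl <;> assumption) Finset.card_le_three (by simp) (by
      rw [Finset.card_empty]
      nlinarith)
  obtain ⟨b, hbs, hbo, hbc, -, hbm⟩ :=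
    exists_even_perm_permuting_cycles a' hqp.pos u hper hdist (finRotate 3)
  rw [orderOf_finRotate_sq_three] at hbo
  let P : Finset α := (Finset.univ ×ˢ Finset.range q).image
    fun z : Fin 3 × ℕ => a'^[z.2] (u z.1)
  have hP : ∀ {x}, (∃ j, SameCycle a' (u j) x) → x ∈ P := fun {x} ⟨j, hj⟩ => by
    obtain ⟨i, hi, h⟩ := hj.exists_iterate_lt hqp.pos (hper j)
    exact Finset.mem_image.2 ⟨(j, i), by simpa using hi, h⟩
  have hPcard : P.card ≤ 3 * q := Finset.card_image_le.trans (by simp)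
  have hz₁P : ∃ j, SameCycle a' (u j) z₁ := hW _ (by simp)
  have hz₂P : ∃ j, SameCycle a' (u j) z₂ := hz₁P.imp fun j hj => sameCycle_apply_right.2 hj
  -- The cycles of `d'` through `z₁` and `z₂` already contain `w₁` and `w₂`, so both points can be
  -- dropped: `3 * q - 2` spoiled cycles plus 4 make `3 * q + 2`.
  let S := (P.erase z₁).erase z₂
  have hScard : S.card ≤ 3 * q - 2 := by
    rw [Finset.card_erase_of_mem (Finset.mem_erase.2 ⟨hz₁₂, hP hz₂P⟩),
      Finset.card_erase_of_mem (hP hz₁P)]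
    omega
  have hS : ∀ w, w ≠ z₁ → w ≠ z₂ → (∃ j, SameCycle a' (u j) w) → w ∈ S := fun w h1 h2 h3 =>
    Finset.mem_erase.2 ⟨h2, Finset.mem_erase.2 ⟨h1, hP h3⟩⟩
  obtain ⟨c, hco, hcc, -, hcS⟩ := HasCycles.exists_commuting (a := d') (q := q) (m := 4) S
    ⟨hqp.pos, d'.support, hperD, by
      have : q * (S.card + 4) ≤ q * (3 * q + 2) := Nat.mul_le_mul_left _ (by omega)
      omega⟩ (by rw [orderOf_finRotate_sq_four]; norm_num)
  rw [orderOf_finRotate_sq_four] at hco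
  have hdisj : Perm.Disjoint b c.1 := fun x => by
    by_cases hx : b x = x
    · exact Or.inl hx
    · refine Or.inr ?_
      by_cases h1 : x = z₁
      · exact hcS w₁ (hS _ hw₁.1 hw₁.2 (hW _ (by simp))) _ (h1 ▸ hw₁z)
      by_cases h2 : x = z₂
      · exact hcS w₂ (hS _ hw₂.1 hw₂.2 (hW _ (by simp))) _ (h2 ▸ hw₂z)
      exact hcS x (hS _ h1 h2 (hbm x hx)) x (SameCycle.refl _ _)
  let b' : {g : alternatingGroup α // g ≠ 1} := ⟨⟨b, mem_alternatingGroup.2 hbs⟩, fun h => by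
    have : b = 1 := congrArg Subtype.val h
    rw [this, orderOf_one] at hbo
    omega⟩
  have hb' : orderOf (b'.1 : Perm α) = 3 := hbo
  refine edist_le_six_of_chain (b := b') (c := c) (edist_le_two_of_commute hbc ?_ ?_ ?_)
    (edist_le_two_of_commute hdisj.commute ?_ ?_ ?_)
    (edist_le_two_of_commute hcc.symm ?_ ?_ ?_)
  all_goals first | rw [hb', hco] | rw [← ha', ha, hb'] | rw [← hd', hd, hco] | rw [← ha', ha] |
    rw [← hd', hd] | rw [hb'] | rw [hco]
  all_goals first | assumption | omega | norm_num

end ProperPowerGraphAlternating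

/-! ### A prime factor at least 5 among three consecutive integers -/

section SmoothTriples

theorem eq_two_of_pow_two_add_two {i j : ℕ} (h : 2 ^ i + 2 = 2 ^ j) : 2 ^ i ≤ 2 := by
  rcases i with _ | _ | i
  · norm_num
  · norm_num
  · rcases j with _ | _ | j
    · rw [pow_zero] at h
      omega
    · rw [zero_add, pow_one] at h
      have : 0 < 2 ^ (i + 1 + 1) := by positivity
      omega
    · rw [pow_succ, pow_succ, pow_succ, pow_succ] at h
      omega

/-- Suppose only 2 and 3 occur and put `m = n - 2`. If `m` is odd, 3 divides both `m` and `m + 2`.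
If `m` is even, 3 divides `m + 1`, so `m` and `m + 2` are powers of 2, forcing `m = 2`. -/
theorem exists_five_le_prime_dvd {n : ℕ} (hn : 5 ≤ n) :
    ∃ p, p.Prime ∧ 5 ≤ p ∧ p ∣ n * (n - 1) * (n - 2) := by
  obtain ⟨m, rfl⟩ : ∃ m, n = m + 2 := ⟨n - 2, by omega⟩
  simp only [Nat.add_sub_cancel, show m + 2 - 1 = m + 1 by omega]
  by_contra! h
  have hp : ∀ p, p.Prime → p ∣ m + 2 ∨ p ∣ m + 1 ∨ p ∣ m → p = 2 ∨ p = 3 := by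
    intro p hp hd
    by_contra! h'
    refine h p hp ?_ ?_
    · by_contra! h5
      have := hp.two_le
      have h4 : p ≠ 4 := by rintro rfl; norm_num at hp
      omega
    · rcases hd with hd | hd | hd
      · exact (hd.mul_right _).mul_right _
      · exact (hd.mul_left _).mul_right _
      · exact hd.mul_left _
  rcases Nat.even_or_odd' m with ⟨k, hk | hk⟩
  · have h3 : 3 ∣ m + 1 := by
      have h1 := Nat.minFac_dvd (m + 1)
      rcases hp _ (Nat.minFac_prime (n := m + 1) (by omega)) (Or.inr (Or.inl h1)) with h2 | h2 <;>
        rw [h2] at h1 <;> omega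
    have h1 := Nat.eq_prime_pow_of_unique_prime_dvd (n := m) (p := 2) (by omega) fun {d} hd hdm => by
      rcases hp d hd (Or.inr (Or.inr hdm)) with h | rfl
      · exact h
      · omega
    have h2 := Nat.eq_prime_pow_of_unique_prime_dvd (n := m + 2) (p := 2) (by omega)
      fun {d} hd hdm => by
      rcases hp d hd (Or.inl hdm) with h | rfl
      · exact h
      · omega
    have := eq_two_of_pow_two_add_two (i := m.primeFactorsList.length)
      (j := (m + 2).primeFactorsList.length) (by rw [← h1, ← h2])
    omega
  · have hdvd : ∀ l, (l = m ∨ l = m + 2) → 3 ∣ l := fun l hl => by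
      have h1 := Nat.minFac_dvd l
      rcases hp _ (Nat.minFac_prime (n := l) (by omega)) (by rcases hl with rfl | rfl <;> simp [h1])
        with h2 | h2 <;> rw [h2] at h1 <;> omega
    have h1 := hdvd m (Or.inl rfl)
    have h2 := hdvd (m + 2) (Or.inr rfl)
    omega

end SmoothTriples

/-! ### Tame elements and the bound 8 -/

section TamePowers

variable {α : Type*} [Fintype α] [DecidableEq α]

/-- An even permutation with many fixed points or of small order. -/
def IsTame (a : Perm α) : Prop :=
  a.support.card + 9 ≤ Fintype.card α ∨ orderOf a ^ 2 ≤ Fintype.card α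

theorem exists_mem_support_inter {a b : Perm α} (hN : 17 ≤ Fintype.card α)
    (ha : Fintype.card α < a.support.card + 9) (hb : Fintype.card α < b.support.card + 9) :
    ∃ z, a z ≠ z ∧ b z ≠ z := by
  have h1 := Finset.card_union_add_card_inter a.support b.support
  have h2 := Finset.card_le_univ (a.support ∪ b.support)
  obtain ⟨z, hz⟩ : (a.support ∩ b.support).Nonempty := Finset.card_pos.1 (by omega)
  rw [Finset.mem_inter, Perm.mem_support, Perm.mem_support] at hz
  exact ⟨z, hz⟩

theorem minimalPeriod_dvd_iff_pow_apply {α : Type*} {x : Perm α} {k : ℕ} {z : α} :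
    minimalPeriod x z ∣ k ↔ (x ^ k) z = z := by
  rw [← isPeriodicPt_iff_minimalPeriod_dvd, ← Perm.iterate_eq_pow]
  rfl

/-- The cycle of `x` through `z` has length dividing `o` but neither `o / r` nor `o / s`. Hence it
is composite with all prime factors at least `r`, so its length is at least `r ^ 2`. -/
theorem minFac_orderOf_sq_le {α : Type*} [Fintype α] {x : Perm α} {o r s : ℕ} (ho : orderOf x = o) (hr : r = o.minFac)
    (hs : s.Prime) (hrs : r * s ∣ o) {z : α} (hz₁ : (x ^ (o / r)) z ≠ z)
    (hz₂ : (x ^ (o / s)) z ≠ z) : r ^ 2 ≤ Fintype.card α := by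
  obtain ⟨t, ht⟩ := hrs
  have hopos : 0 < o := ho ▸ orderOf_pos x
  have hr0 : 0 < r := Nat.pos_of_ne_zero (by rintro rfl; simp at ht; omega)
  have h1 : o / r = s * t := by rw [ht, mul_assoc, Nat.mul_div_cancel_left _ hr0]
  have h2 : o / s = r * t := by
    rw [ht, mul_comm r s, mul_assoc, Nat.mul_div_cancel_left _ hs.pos]
  rw [Ne, ← minimalPeriod_dvd_iff_pow_apply, h1] at hz₁
  rw [Ne, ← minimalPeriod_dvd_iff_pow_apply, h2] at hz₂
  have hm : minimalPeriod x z ∣ r * (s * t) := by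
    rw [minimalPeriod_dvd_iff_pow_apply, ← mul_assoc, ← ht, ← ho, pow_orderOf_eq_one,
      Perm.one_apply]
  have hmo : minimalPeriod x z ∣ o := by rwa [ht, mul_assoc]
  have hmpos : 0 < minimalPeriod x z := Nat.pos_of_dvd_of_pos hmo hopos
  have hnp : ¬ (minimalPeriod x z).Prime := fun hp =>
    (hp.dvd_mul.1 hm).elim (fun h => hz₂ (h.mul_right t)) hz₁
  have hne : minimalPeriod x z ≠ 1 := fun h => hz₁ (h ▸ one_dvd _)
  have hle : r ≤ (minimalPeriod x z).minFac := by
    rw [hr]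
    exact Nat.minFac_le_of_dvd (Nat.minFac_prime hne).two_le ((Nat.minFac_dvd _).trans hmo)
  calc r ^ 2 ≤ (minimalPeriod x z).minFac ^ 2 := Nat.pow_le_pow_left hle 2
    _ ≤ minimalPeriod x z := Nat.minFac_sq_le_self hmpos hnp
    _ ≤ Fintype.card α := by
      rw [← Finset.card_univ, ← Finset.card_range (minimalPeriod x z)]
      refine Finset.card_le_card_of_injOn (fun i => x^[i] z) (fun _ _ => by simp) ?_
      rw [Finset.coe_range]
      exact iterate_injOn_Iio_minimalPeriod

/-- An element of composite order has a tame power of prime order. -/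
theorem exists_isTame_pow {x : Perm α} (hN : 17 ≤ Fintype.card α) (hx : x ≠ 1)
    (hxp : ¬ (orderOf x).Prime) :
    ∃ k : ℕ, (orderOf (x ^ k)).Prime ∧ IsTame (x ^ k) := by
  have h1 : orderOf x ≠ 1 := fun h => hx (orderOf_eq_one_iff.1 h)
  have hpos := orderOf_pos x
  have hr := Nat.minFac_prime h1
  obtain ⟨t, ht⟩ := Nat.minFac_dvd (orderOf x)
  have ht1 : t ≠ 1 := by
    rintro rfl
    rw [mul_one] at ht
    exact hxp (ht ▸ hr)
  have hs := Nat.minFac_prime ht1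
  have hrs : (orderOf x).minFac * t.minFac ∣ orderOf x := by
    conv_rhs => rw [ht]
    exact Nat.mul_dvd_mul_left _ (Nat.minFac_dvd t)
  have hor : ∀ p, p ∣ orderOf x → orderOf (x ^ (orderOf x / p)) = p := fun p hp =>
    orderOf_pow_orderOf_div hpos.ne' hp
  have hro := hor _ (Nat.minFac_dvd _)
  have hso := hor _ (dvd_of_mul_left_dvd hrs)
  by_cases ha : (x ^ (orderOf x / (orderOf x).minFac)).support.card + 9 ≤ Fintype.card α
  · exact ⟨_, by rwa [hro], Or.inl ha⟩
  by_cases hb : (x ^ (orderOf x / t.minFac)).support.card + 9 ≤ Fintype.card α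
  · exact ⟨_, by rwa [hso], Or.inl hb⟩
  -- Each power fixes at most 8 of at least 17 points, so some point is moved by both.
  obtain ⟨z, hz₁, hz₂⟩ := exists_mem_support_inter hN (not_le.1 ha) (not_le.1 hb)
  refine ⟨_, by rwa [hro], Or.inr ?_⟩
  rw [hro]
  exact minFac_orderOf_sq_le rfl rfl hs hrs hz₁ hz₂

/-- Nine is the worst demand made later: 4 cycles spoiled by a `b` on 4 fixed points, plus 5 for a
`c` of order 5. The bound 87 is `5 * 17 + 2`. -/
theorem IsTame.hasCycles {a : Perm α} (h : IsTame a) (ha : (orderOf a).Prime)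
    (hN : 87 ≤ Fintype.card α) : ∃ q, HasCycles a q 9 := by
  by_cases hf : a.support.card + 9 ≤ Fintype.card α
  · exact ⟨1, hasCycles_one hf⟩
  · have hsq := h.resolve_left hf
    refine ⟨_, hasCycles_orderOf ha ?_⟩
    generalize orderOf a = p at *
    by_cases hp : p ≤ 7
    · omega
    · have : p ≠ 8 := by rintro rfl; norm_num at ha
      have : p ≠ 9 := by rintro rfl; norm_num at ha
      have : 10 ≤ p := by omega
      nlinarith

theorem edist_le_six_of_small_support {a d : {g : alternatingGroup α // g ≠ 1}}
    (ha : (orderOf (a.1 : Perm α)).Prime) (hd : (orderOf (d.1 : Perm α)).Prime)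
    (hN : 87 ≤ Fintype.card α) (hdt : IsTame (d.1 : Perm α))
    (h : ((a.1 : Perm α).support.card + 3 ≤ Fintype.card α ∧ orderOf (a.1 : Perm α) ≠ 3) ∨
      (a.1 : Perm α).support.card + 9 ≤ Fintype.card α) :
    (properPowerGraph (alternatingGroup α)).edist a d ≤ 6 := by
  obtain ⟨q, hq⟩ := hdt.hasCycles hd hN
  by_cases ha3 : orderOf (a.1 : Perm α) = 3
  · have h9 := h.resolve_left fun h' => h'.2 ha3
    have h₁ : HasCycles (a.1 : Perm α) 1 4 := hasCycles_one (by omega)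
    by_cases hd3 : orderOf (d.1 : Perm α) = 3
    · exact edist_le_six_of_hasCycles ha hd orderOf_finRotate_sq_four orderOf_finRotate_sq_five
        (by norm_num) (by norm_num) h₁ (hq.mono (by norm_num)) (by omega) (by omega) (by norm_num)
    · exact edist_le_six_of_hasCycles ha hd orderOf_finRotate_sq_four orderOf_finRotate_sq_three
        (by norm_num) (by norm_num) h₁ (hq.mono (by norm_num)) (by omega) (by omega) (by norm_num)
  · have h₁ : HasCycles (a.1 : Perm α) 1 3 := hasCycles_one (by omega)
    by_cases hd2 : orderOf (d.1 : Perm α) = 2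
    · exact edist_le_six_of_hasCycles ha hd orderOf_finRotate_sq_three orderOf_finRotate_sq_five
        (by norm_num) (by norm_num) h₁ (hq.mono (by norm_num)) (by omega) (by omega) (by norm_num)
    · exact edist_le_six_of_hasCycles ha hd orderOf_finRotate_sq_three orderOf_finRotate_sq_four
        (by norm_num) (by norm_num) h₁ (hq.mono (by norm_num)) (by omega) (by omega) (by norm_num)

theorem edist_le_six_of_orderOf_eq_three {P : ℕ} (hP : 5 ≤ P)
    (hN : P * (3 * P + 2) + 2 ≤ Fintype.card α) {a d : {g : alternatingGroup α // g ≠ 1}}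
    (ha : orderOf (a.1 : Perm α) = 3) (hd : (orderOf (d.1 : Perm α)).Prime)
    (has : Fintype.card α ≤ (a.1 : Perm α).support.card + 8)
    (hds : (orderOf (d.1 : Perm α) = 3 ∧ Fintype.card α ≤ (d.1 : Perm α).support.card + 8) ∨
      (orderOf (d.1 : Perm α) ≤ P ∧ Fintype.card α ≤ (d.1 : Perm α).support.card + 2)) :
    (properPowerGraph (alternatingGroup α)).edist a d ≤ 6 := by
  have hN87 : 87 ≤ Fintype.card α := by nlinarith
  have hap : (orderOf (a.1 : Perm α)).Prime := by rw [ha]; norm_num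
  by_cases hd3 : orderOf (d.1 : Perm α) = 3
  · exact edist_le_six_of_hasCycles hap hd orderOf_finRotate_sq_four orderOf_finRotate_sq_five
      (by norm_num) (by norm_num) (hasCycles_orderOf hap (by omega))
      (hasCycles_orderOf hd (by rw [ha, hd3]; omega)) (by omega) (by omega) (by norm_num)
  · obtain ⟨hdP, hds⟩ := hds.resolve_left fun h => hd3 h.1
    rw [SimpleGraph.edist_comm]
    exact edist_le_six_of_hasCycles hd hap orderOf_finRotate_sq_three orderOf_finRotate_sq_four
      (by norm_num) (by norm_num) (hasCycles_orderOf hd (by nlinarith))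
      (hasCycles_orderOf hap (by rw [ha]; nlinarith)) (by omega) (by omega) (by norm_num)

theorem edist_le_six_of_orderOf_eq_two {P : ℕ} (hP : 5 ≤ P)
    (hN : P * (3 * P + 2) + 2 ≤ Fintype.card α) {a d : {g : alternatingGroup α // g ≠ 1}}
    (ha : orderOf (a.1 : Perm α) = 2) (hd : (orderOf (d.1 : Perm α)).Prime)
    (has : Fintype.card α ≤ (a.1 : Perm α).support.card + 2) (hdP : orderOf (d.1 : Perm α) ≤ P)
    (hds : Fintype.card α ≤ (d.1 : Perm α).support.card + 2) :
    (properPowerGraph (alternatingGroup α)).edist a d ≤ 6 := by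
  have hN87 : 87 ≤ Fintype.card α := by nlinarith
  have hap : (orderOf (a.1 : Perm α)).Prime := by rw [ha]; norm_num
  by_cases hd2 : orderOf (d.1 : Perm α) = 2
  · exact edist_le_six_of_hasCycles hap hd orderOf_finRotate_sq_three orderOf_finRotate_sq_five
      (by norm_num) (by norm_num) (hasCycles_orderOf hap (by omega))
      (hasCycles_orderOf hd (by rw [ha]; nlinarith)) (by omega) (by omega) (by norm_num)
  · exact edist_le_six_of_hasCycles hap hd orderOf_finRotate_sq_three orderOf_finRotate_sq_four
      (by norm_num) (by norm_num) (hasCycles_orderOf hap (by omega))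
      (hasCycles_orderOf hd (by rw [ha]; nlinarith)) (by omega) (by omega) (by norm_num)

/-- When `a` has order at most `P - 1`, `b` spoils at most `3 * P - 3` cycles of `d`; with the 4
needed for `c` this stays below `3 * P + 2`. -/
theorem edist_le_six_of_orderOf_lt {P : ℕ} (hP : 5 ≤ P)
    (hN : P * (3 * P + 2) + 2 ≤ Fintype.card α) {a d : {g : alternatingGroup α // g ≠ 1}}
    (ha : (orderOf (a.1 : Perm α)).Prime) (hd : (orderOf (d.1 : Perm α)).Prime)
    (ha3 : orderOf (a.1 : Perm α) ≠ 3) (hd2 : orderOf (d.1 : Perm α) ≠ 2)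
    (haP : orderOf (a.1 : Perm α) < P) (hdP : orderOf (d.1 : Perm α) ≤ P)
    (has : Fintype.card α ≤ (a.1 : Perm α).support.card + 2)
    (hds : Fintype.card α ≤ (d.1 : Perm α).support.card + 2) :
    (properPowerGraph (alternatingGroup α)).edist a d ≤ 6 := by
  refine edist_le_six_of_hasCycles ha hd orderOf_finRotate_sq_three orderOf_finRotate_sq_four
      (by norm_num) (by norm_num) (hasCycles_orderOf ha (by nlinarith))
      (hasCycles_orderOf hd ?_) (by omega) (by omega) (by norm_num)
  have : orderOf (d.1 : Perm α) * (orderOf (a.1 : Perm α) * 3 + 4) ≤ P * (3 * P + 2) :=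
    Nat.mul_le_mul hdP (by omega)
  omega

theorem edist_le_six_of_isTame {P : ℕ} (hP : 5 ≤ P) (hPp : P.Prime)
    (hN : P * (3 * P + 2) + 2 ≤ Fintype.card α)
    (hle : ∀ g : Perm α, (orderOf g).Prime → Fintype.card α ≤ g.support.card + 2 → orderOf g ≤ P)
    {a d : {g : alternatingGroup α // g ≠ 1}}
    (ha : (orderOf (a.1 : Perm α)).Prime) (hd : (orderOf (d.1 : Perm α)).Prime)
    (hat : IsTame (a.1 : Perm α)) (hdt : IsTame (d.1 : Perm α)) :
    (properPowerGraph (alternatingGroup α)).edist a d ≤ 6 := by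
  have hN87 : 87 ≤ Fintype.card α := by nlinarith
  by_cases hA : ((a.1 : Perm α).support.card + 3 ≤ Fintype.card α ∧ orderOf (a.1 : Perm α) ≠ 3) ∨
      (a.1 : Perm α).support.card + 9 ≤ Fintype.card α
  · exact edist_le_six_of_small_support ha hd hN87 hdt hA
  by_cases hD : ((d.1 : Perm α).support.card + 3 ≤ Fintype.card α ∧ orderOf (d.1 : Perm α) ≠ 3) ∨
      (d.1 : Perm α).support.card + 9 ≤ Fintype.card α
  · rw [SimpleGraph.edist_comm]
    exact edist_le_six_of_small_support hd ha hN87 hat hD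
  have haP := hle _ ha
  have hdP := hle _ hd
  by_cases ha3 : orderOf (a.1 : Perm α) = 3
  · exact edist_le_six_of_orderOf_eq_three hP hN ha3 hd (by omega) (by omega)
  by_cases hd3 : orderOf (d.1 : Perm α) = 3
  · rw [SimpleGraph.edist_comm]
    exact edist_le_six_of_orderOf_eq_three hP hN hd3 ha (by omega) (by omega)
  have has : Fintype.card α ≤ (a.1 : Perm α).support.card + 2 := by omega
  have hds : Fintype.card α ≤ (d.1 : Perm α).support.card + 2 := by omega
  replace haP := haP has
  replace hdP := hdP hds
  by_cases ha2 : orderOf (a.1 : Perm α) = 2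
  · exact edist_le_six_of_orderOf_eq_two hP hN ha2 hd has hdP hds
  by_cases hd2 : orderOf (d.1 : Perm α) = 2
  · rw [SimpleGraph.edist_comm]
    exact edist_le_six_of_orderOf_eq_two hP hN hd2 ha hds haP has
  rcases haP.lt_or_eq with haP' | haP'
  · exact edist_le_six_of_orderOf_lt hP hN ha hd ha3 hd2 haP' hdP has hds
  rcases hdP.lt_or_eq with hdP' | hdP'
  · rw [SimpleGraph.edist_comm]
    exact edist_le_six_of_orderOf_lt hP hN hd ha hd3 ha2 hdP' haP hds has
  exact edist_le_six_of_orderOf_eq hPp haP' hdP' hP has hds hN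

/-- Composite orders have a tame power. Order 3 is tame since `9 ≤ n`, and a prime-order element
with at most two fixed points has order at most `P`, hence is tame since `P ^ 2 ≤ n`. -/
theorem exists_isTame_or_prime {P : ℕ} (hP : 5 ≤ P)
    (hN : P * (3 * P + 2) + 2 ≤ Fintype.card α)
    (hle : ∀ g : Perm α, (orderOf g).Prime → Fintype.card α ≤ g.support.card + 2 → orderOf g ≤ P)
    (x : {g : alternatingGroup α // g ≠ 1}) :
    (∃ a : {g : alternatingGroup α // g ≠ 1},
      (properPowerGraph (alternatingGroup α)).edist x a ≤ 1 ∧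
        (orderOf (a.1 : Perm α)).Prime ∧ IsTame (a.1 : Perm α)) ∨
      ((orderOf (x.1 : Perm α)).Prime ∧ orderOf (x.1 : Perm α) ≠ 3 ∧
        (x.1 : Perm α).support.card + 3 ≤ Fintype.card α) := by
  have hN87 : 87 ≤ Fintype.card α := by nlinarith
  by_cases hxp : (orderOf (x.1 : Perm α)).Prime
  · by_cases ht : IsTame (x.1 : Perm α)
    · exact Or.inl ⟨x, by simp, hxp, ht⟩
    · rw [IsTame, not_or, not_le, not_le] at ht
      refine Or.inr ⟨hxp, fun h3 => ?_, ?_⟩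
      · rw [h3] at ht
        omega
      · by_contra! hs
        have := hle _ hxp (by omega)
        nlinarith
  · obtain ⟨k, hk, ht⟩ := exists_isTame_pow (by omega)
      (fun h => x.2 (Subtype.ext h)) hxp
    refine Or.inl ⟨⟨x.1 ^ k, fun h => hk.ne_one ?_⟩, properPowerGraph_edist_le_one k rfl, hk, ht⟩
    rw [orderOf_eq_one_iff]
    exact congrArg Subtype.val h

theorem edist_le_eight {P : ℕ} (hP : 5 ≤ P) (hPp : P.Prime)
    (hN : P * (3 * P + 2) + 2 ≤ Fintype.card α)
    (hle : ∀ g : Perm α, (orderOf g).Prime → Fintype.card α ≤ g.support.card + 2 → orderOf g ≤ P)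
    (x y : {g : alternatingGroup α // g ≠ 1}) :
    (properPowerGraph (alternatingGroup α)).edist x y ≤ 8 := by
  have hN87 : 87 ≤ Fintype.card α := by nlinarith
  have key : ∀ {x a y : {g : alternatingGroup α // g ≠ 1}},
      (properPowerGraph (alternatingGroup α)).edist x a ≤ 6 →
      (properPowerGraph (alternatingGroup α)).edist y a ≤ 1 →
      (properPowerGraph (alternatingGroup α)).edist x y ≤ 7 := fun {x a y} h1 h2 => by
    rw [SimpleGraph.edist_comm] at h2
    calc _ ≤ _ := SimpleGraph.edist_triangle
      _ ≤ 6 + 1 := add_le_add h1 h2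
      _ = 7 := by norm_num
  have h78 : (7 : ℕ∞) ≤ 8 := by norm_num
  rcases exists_isTame_or_prime hP hN hle x with ⟨a, hxa, hap, hat⟩ | ⟨hxp, hx3, hxs⟩ <;>
    rcases exists_isTame_or_prime hP hN hle y with ⟨d, hyd, hdp, hdt⟩ | ⟨hyp, hy3, hys⟩
  · calc _ ≤ _ := SimpleGraph.edist_triangle
      _ ≤ 1 + 7 := add_le_add hxa (key (edist_le_six_of_isTame hP hPp hN hle hap hdp hat hdt) hyd)
      _ = 8 := by norm_num
  · rw [SimpleGraph.edist_comm]
    exact (key (edist_le_six_of_small_support hyp hap hN87 hat (Or.inl ⟨hys, hy3⟩)) hxa).trans h78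
  · exact (key (edist_le_six_of_small_support hxp hdp hN87 hdt (Or.inl ⟨hxs, hx3⟩)) hyd).trans h78
  · exact edist_le_eight_of_three_fixed hxp hyp hx3 hy3 hxs hys (by omega)

end TamePowers

end

theorem mainTheorem4 (n p' : ℕ) (hn : 3 ≤ n)
    (hp' : IsGreatest {p : ℕ | p.Prime ∧ p ∣ n * (n - 1) * (n - 2)} p')
    (h : 3 * p' + 2 ≤ (n - 2) / p') :
    (properPowerGraph (alternatingGroup (Fin n))).Connected ∧
      (properPowerGraph (alternatingGroup (Fin n))).diam ≤ 8 := by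
  obtain ⟨⟨hpp, -⟩, hmax⟩ := hp'
  have hle : p' * (3 * p' + 2) ≤ n - 2 := by
    rw [mul_comm]
    exact (Nat.le_div_iff_mul_le hpp.pos).1 h
  have hn5 : 5 ≤ n := by
    have := hpp.two_le
    nlinarith [Nat.sub_add_cancel (by omega : 2 ≤ n)]
  have h5 : 5 ≤ p' := by
    obtain ⟨p, hp, hp5, hd⟩ := exists_five_le_prime_dvd hn5
    exact hp5.trans (hmax ⟨hp, hd⟩)
  have hedist := edist_le_eight (α := Fin n) h5 hpp (by rw [Fintype.card_fin]; omega)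
    -- All nontrivial cycles of `g` have length `orderOf g`, which therefore divides the number of
    -- moved points.
    (fun g hg hs => by
      refine hmax ⟨hg, ?_⟩
      have hd := orderOf_dvd_card_support hg
      have hc := Finset.card_le_univ g.support
      rw [Fintype.card_fin] at hs hc
      obtain h0 | h0 | h0 : g.support.card = n ∨ g.support.card = n - 1 ∨
        g.support.card = n - 2 := by omega
      · exact (h0 ▸ hd).mul_right _ |>.mul_right _
      · exact ((h0 ▸ hd).mul_left _).mul_right _
      · exact (h0 ▸ hd).mul_left _)
  have hediam : (properPowerGraph (alternatingGroup (Fin n))).ediam ≤ 8 :=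
    SimpleGraph.ediam_le_of_edist_le hedist
  have : Nonempty {g : alternatingGroup (Fin n) // g ≠ 1} := by
    obtain ⟨c, -⟩ := HasCycles.exists_commuting (a := (1 : Equiv.Perm (Fin n))) (q := 1) (m := 3) ∅
      (hasCycles_one (by simpa using hn)) (by rw [orderOf_finRotate_sq_three]; norm_num)
    exact ⟨c⟩
  refine ⟨SimpleGraph.connected_of_ediam_ne_top (ne_top_of_le_ne_top (by simp) hediam), ?_⟩
  exact ENat.toNat_le_of_le_natCast hediam
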